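/- Let $C\subseteq\mathbb{R}^n$ be closed, convex and non-empty, let $P_C(z)=\{x\in C:\ \|z-x\|\le\|z-w\|\ \text{for all } w\in C\}$ denote the Euclidean projection onto $C$, let $h:\mathbb{R}^n\to\mathbb{R}$ be an arbitrary function, and let $K:C\rightrightarrows\mathbb{R}^n$ be a set-valued map with non-empty values such that $K(C)=\bigcup_{x\in C}K(x)$ is relatively compact. A set-valued map $T:X\rightrightarrows\mathbb{R}^n$ on a topological space $X$ is called lower semicontinuous (lsc) if for every $x\in X$ and every open set $V$ with $T(x)\cap V\neq\emptyset$ there is a neighbourhood $U$ of $x$ such that $T(x')\cap V\neq\emptyset$ for all $x'\in U$. Assume that 1. $K$ is lsc with convex values; 2. the set $D=\{(x,z)\in C\times\mathbb{R}^n:\ z\in K(x)\text{ and }x\in P_C(z)\}$ is closed; 3. the set-valued map $H:D\rightrightarrows\mathbb{R}^n$, $H(x,z)=\{y\in K(x):\ h(y)<h(z)\}$, is lsc with convex (possibly empty) values. Then the quasi-optimization problem associated with $h$ and $K$ has a projected solution, that is, there exist $x_0\in C$ and $z_0\in K(x_0)$ such that $h(z_0)\le h(y)$ for all $y\in K(x_0)$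 and $x_0\in P_C(z_0)$. -/

import Mathlib

/-- The projection of `z` onto `C`, as a set: the points of `C` that are nearest to `z` in the
Euclidean norm. -/
def projSet {n : ℕ} (C : Set (EuclideanSpace ℝ (Fin n))) (z : EuclideanSpace ℝ (Fin n)) :
    Set (EuclideanSpace ℝ (Fin n)) :=
  {x | x ∈ C ∧ ∀ w ∈ C, ‖z - x‖ ≤ ‖z - w‖}

/-- The set of global minimizers of `h` over `S`. -/
def argminSet {n : ℕ} (h : EuclideanSpace ℝ (Fin n) → ℝ) (S : Set (EuclideanSpace ℝ (Fin n))) :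
    Set (EuclideanSpace ℝ (Fin n)) :=
  {z | z ∈ S ∧ ∀ y ∈ S, h z ≤ h y}

/-- `x₀ ∈ C` is a projected solution of the quasi-optimization problem given by the objective `h`
and the constraint map `K : C ⇉ ℝⁿ`: it is a projection onto `C` of some minimizer of `h` over
`K x₀`. -/
def IsProjectedSolutionQOpt {n : ℕ} (C : Set (EuclideanSpace ℝ (Fin n)))
    (h : EuclideanSpace ℝ (Fin n) → ℝ) (K : C → Set (EuclideanSpace ℝ (Fin n))) (x₀ : C) : Prop :=
  ∃ z₀ ∈ argminSet h (K x₀), (x₀ : EuclideanSpace ℝ (Fin n)) ∈ projSet C z₀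

/-- The set `D` of pairs `(x, z) ∈ C × ℝⁿ` with `z ∈ K x` and `x ∈ P_C(z)`. -/
def projFixSet {n : ℕ} (C : Set (EuclideanSpace ℝ (Fin n)))
    (K : C → Set (EuclideanSpace ℝ (Fin n))) : Set (C × EuclideanSpace ℝ (Fin n)) :=
  {p | p.2 ∈ K p.1 ∧ (p.1 : EuclideanSpace ℝ (Fin n)) ∈ projSet C p.2}

/-- The set-valued map `H : D ⇉ ℝⁿ`, `H(x, z) = {y ∈ K x | h y < h z}`. -/
def improvementMap {n : ℕ} (C : Set (EuclideanSpace ℝ (Fin n)))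
    (h : EuclideanSpace ℝ (Fin n) → ℝ) (K : C → Set (EuclideanSpace ℝ (Fin n))) :
    projFixSet C K → Set (EuclideanSpace ℝ (Fin n)) :=
  fun p => {y | y ∈ K p.1.1 ∧ h y < h p.1.2}

/-! Suppose there is no projected solution and let `P` be the metric projection, which is
single-valued and continuous. Start from `z ↦ K (P z)` on the whole space and, on the closed set of
`z ∈ K (P z)`, shrink its value to the points of `K (P z)` that strictly improve on `z`. These are
non-empty because `z` is never optimal, and shrinking on a closed set keeps lower semicontinuity.
The new map has a fixed point `z`. Inside the closed set this gives `h z < h z`; outside, it puts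
`z` in that set. Both are absurd.

The fixed point comes from a continuous selection and Brouwer's theorem. Values need not be closed,
so the selection is a weighted series of selections of the closures, dense in each value: its sum
cannot be properly separated from the convex value, hence lies in it. Brouwer follows from the
absence of a `C¹` retraction onto the sphere, by a volume computation polynomial in time. -/

open Set Filter Topology MeasureTheory Metric

/-! ### Metric projection onto a convex set -/

section Projection

variable {E : Type*} [NormedAddCommGroup E] [InnerProductSpace ℝ E]

/-- The metric projection onto a complete convex set is a nonexpansive map characterized by a
variational inequality. -/
theorem exists_metricProjection {C : Set E} (hne : C.Nonempty) (hc : IsComplete C)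
    (hconv : Convex ℝ C) :
    ∃ P : E → E, LipschitzWith 1 P ∧ (∀ z, P z ∈ C) ∧ (∀ z, ∀ w ∈ C, ‖z - P z‖ ≤ ‖z - w‖) ∧
      ∀ z, ∀ w ∈ C, inner ℝ (z - P z) (w - P z) ≤ 0 := by
  choose P hPC hP using exists_norm_eq_iInf_of_complete_convex hne hc hconv
  have hin : ∀ z, ∀ w ∈ C, inner ℝ (z - P z) (w - P z) ≤ 0 := fun z =>
    (norm_eq_iInf_iff_real_inner_le_zero hconv (hPC z)).1 (hP z)
  refine ⟨P, LipschitzWith.of_dist_le_mul fun x y => ?_, hPC, fun z w hw => ?_, hin⟩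
  · have h1 := hin x (P y) (hPC y)
    have h2 := hin y (P x) (hPC x)
    have h3 : ‖P x - P y‖ ^ 2 ≤ inner ℝ (x - y) (P x - P y) := by
      rw [← real_inner_self_eq_norm_sq]
      simp only [inner_sub_left, inner_sub_right] at *
      have := real_inner_comm (P x) (P y)
      linarith
    have h4 := real_inner_le_norm (x - y) (P x - P y)
    rw [dist_eq_norm, dist_eq_norm, NNReal.coe_one, one_mul]
    by_contra! hlt
    nlinarith [norm_nonneg (x - y)]
  · rw [hP z]
    exact ciInf_le ⟨0, by rintro _ ⟨w, rfl⟩; exact norm_nonneg _⟩ (⟨w, hw⟩ : C)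

end Projection

/-! ### Determinants of `1 + t • A` and polynomial interpolation -/

section Retraction

variable {E : Type*} [NormedAddCommGroup E] [InnerProductSpace ℝ E] [FiniteDimensional ℝ E]

theorem ContinuousLinearMap.exists_polynomial_det_one_add_smul (A : E →L[ℝ] E) :
    ∃ p : Polynomial ℝ, p.natDegree ≤ Module.finrank ℝ E ∧
      ∀ t : ℝ, p.eval t = (1 + t • A).det := by
  let b := Module.finBasis ℝ E
  let M := LinearMap.toMatrix b b (A : E →ₗ[ℝ] E)
  refine ⟨((Polynomial.X : Polynomial ℝ) • M.map Polynomial.C +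
    (1 : Matrix _ _ ℝ).map Polynomial.C).det, ?_, fun t => ?_⟩
  · simpa using Polynomial.natDegree_det_X_add_C_le M 1
  · rw [ContinuousLinearMap.det, ← LinearMap.det_toMatrix b,
      ← Polynomial.coe_evalRingHom, RingHom.map_det]
    congr 1
    ext i j
    simp [M, Matrix.one_apply, LinearMap.toMatrix_apply, add_comm,
      Finsupp.single_apply, eq_comm]
    split_ifs <;> simp [mul_comm]

/-- Along `s ∈ [0, 1]` the Neumann series keeps `1 + s • A` invertible, so the determinant cannot
change sign from its value `1` at `s = 0`. -/
theorem ContinuousLinearMap.det_one_add_pos_of_norm_lt_one {A : E →L[ℝ] E} (hA : ‖A‖ < 1) :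
    0 < (1 + A).det := by
  have hne : ∀ s ∈ Icc (0 : ℝ) 1, (1 + s • A).det ≠ 0 := by
    intro s hs
    have hlt : ‖-(s • A)‖ < 1 := by
      rw [norm_neg, norm_smul, Real.norm_of_nonneg hs.1]
      nlinarith [norm_nonneg A, hs.2]
    have hu : IsUnit (1 + s • A) := by
      simpa using (Units.oneSub (-(s • A)) hlt).isUnit
    have := hu.map (ContinuousLinearMap.toLinearMapRingHom : (E →L[ℝ] E) →+* (E →ₗ[ℝ] E))
    exact (LinearMap.isUnit_det _ this).ne_zero
  have hcont : Continuous fun s : ℝ => (1 + s • A).det :=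
    ContinuousLinearMap.continuous_det.comp (by fun_prop)
  by_contra! hle
  have h0 : (0 : ℝ) ≤ (1 + (0 : ℝ) • A).det := by
    simp [ContinuousLinearMap.det]
  obtain ⟨s, hs, hs0⟩ := intermediate_value_Icc' zero_le_one hcont.continuousOn
    (show (0 : ℝ) ∈ Icc _ _ from ⟨by simpa using hle, h0⟩)
  exact hne s hs hs0

/-- A weighted combination of finitely many small parameters reproduces the value at `1` of every
polynomial of bounded degree. -/
theorem exists_interpolation_weights (d : ℕ) {δ : ℝ} (hδ : 0 < δ) :
    ∃ (t c : Fin (d + 1) → ℝ), (∀ i, 0 ≤ t i ∧ t i < δ) ∧ ∑ i, c i = 1 ∧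
      ∀ p : Polynomial ℝ, p.natDegree ≤ d → p.eval 1 = ∑ i, c i * p.eval (t i) := by
  let t : Fin (d + 1) → ℝ := fun i => δ * (i : ℝ) / (d + 1)
  have hinj : Function.Injective t := by
    intro i j hij
    have hd : (0 : ℝ) < d + 1 := by positivity
    simp only [t] at hij
    field_simp at hij
    exact Fin.ext (by exact_mod_cast hij)
  let c : Fin (d + 1) → ℝ := fun i => (Lagrange.basis Finset.univ t i).eval 1
  have key : ∀ p : Polynomial ℝ, p.natDegree ≤ d → p.eval 1 = ∑ i, c i * p.eval (t i) := by
    intro p hp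
    have hdeg : p.degree < (Finset.univ : Finset (Fin (d + 1))).card := by
      refine lt_of_le_of_lt Polynomial.degree_le_natDegree ?_
      simp only [Finset.card_univ, Fintype.card_fin]
      exact_mod_cast Nat.lt_succ_of_le hp
    conv_lhs => rw [Lagrange.eq_interpolate hinj.injOn hdeg, Lagrange.interpolate_apply]
    simp [Polynomial.eval_finsetSum, c, mul_comm]
  refine ⟨t, c, fun i => ⟨by positivity, ?_⟩, ?_, key⟩
  · have hi : (i : ℝ) < d + 1 := by exact_mod_cast i.2
    simp only [t]
    rw [div_lt_iff₀ (by positivity)]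
    gcongr
  · simpa using (key 1 (by simp)).symm

end Retraction

/-! ### No `C¹` retraction onto the sphere -/

section Retraction

variable {E : Type*} [NormedAddCommGroup E] [InnerProductSpace ℝ E] [FiniteDimensional ℝ E]

theorem LipschitzWith.bijective_add_smul {L : NNReal} {g : E → E} (hg : LipschitzWith L g)
    {t : ℝ} (ht : 0 ≤ t) (htL : t * L < 1) : Function.Bijective fun x => x + t • g x := by
  rcases subsingleton_or_nontrivial E with hE | hE
  · exact ⟨fun x y _ => Subsingleton.elim _ _, fun y => ⟨y, Subsingleton.elim _ _⟩⟩
  lift t to NNReal using ht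
  have hA : ApproximatesLinearOn (fun x => x + (t : ℝ) • g x)
      ((ContinuousLinearEquiv.refl ℝ E : E ≃L[ℝ] E) : E →L[ℝ] E) univ (t * L) := by
    intro x _ y _
    have h1 := hg.dist_le_mul x y
    rw [dist_eq_norm, dist_eq_norm] at h1
    have h2 : x + (t : ℝ) • g x - (y + (t : ℝ) • g y) - (x - y) = (t : ℝ) • (g x - g y) := by
      rw [smul_sub]; abel
    simp only [ContinuousLinearEquiv.coe_coe, ContinuousLinearEquiv.coe_refl',
      id_eq, h2, norm_smul, NNReal.norm_eq, NNReal.coe_mul, mul_assoc]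
    gcongr
  have hc : t * L < ‖(((ContinuousLinearEquiv.refl ℝ E).symm : E ≃L[ℝ] E) : E →L[ℝ] E)‖₊⁻¹ := by
    have : ‖(((ContinuousLinearEquiv.refl ℝ E).symm : E ≃L[ℝ] E) : E →L[ℝ] E)‖₊ = 1 :=
      nnnorm_one (G := E →L[ℝ] E)
    rw [this, inv_one]
    exact_mod_cast htL
  exact ⟨injOn_univ.1 (hA.injOn (Or.inr hc)), hA.surjective (Or.inr hc)⟩

/-- A `C¹` displacement which is Lipschitz and vanishes off the open unit ball has the same
average Jacobian determinant at time `1` as at time `0`. -/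
theorem setIntegral_det_one_add_eq_volume [MeasurableSpace E] [BorelSpace E] {L : NNReal}
    {g : E → E} (hg : LipschitzWith L g) (hg0 : ∀ x, x ∉ ball (0 : E) 1 → g x = 0)
    {A : E → E →L[ℝ] E} (hA : ∀ x ∈ ball (0 : E) 1, HasFDerivAt g (A x) x)
    (hAc : ContinuousOn A (closedBall 0 1)) :
    ∫ x in ball (0 : E) 1, (1 + A x).det = volume.real (ball (0 : E) 1) := by
  have hAL : ∀ x ∈ ball (0 : E) 1, ‖A x‖ ≤ L := fun x hx =>
    (hA x hx).le_of_lipschitz hg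
  have hint : ∀ t : ℝ, IntegrableOn (fun x => (1 + t • A x).det) (ball (0 : E) 1) := fun t =>
    (ContinuousOn.integrableOn_compact (isCompact_closedBall (0 : E) 1)
      (ContinuousLinearMap.continuous_det.comp_continuousOn
        (continuousOn_const.add (hAc.const_smul t)))).mono_set ball_subset_closedBall
  -- For small `t` the map `x + t • g x` is a bijection fixing everything off the ball, so it
  -- permutes the ball; change of variables gives the volume.
  have hsmall : ∀ t : ℝ, 0 ≤ t → t < ((L : ℝ) + 1)⁻¹ →
      ∫ x in ball (0 : E) 1, (1 + t • A x).det = volume.real (ball (0 : E) 1) := by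
    intro t ht htL
    have hL1 : t * ((L : ℝ) + 1) < 1 := by
      rwa [← one_div, lt_div_iff₀ (by positivity)] at htL
    have htL : t * L < 1 := by nlinarith [L.coe_nonneg]
    have hbij := hg.bijective_add_smul ht htL
    have himage : (fun x => x + t • g x) '' ball (0 : E) 1 = ball 0 1 := by
      have hfix : ∀ x, x ∉ ball (0 : E) 1 → x + t • g x = x := fun x hx => by simp [hg0 x hx]
      apply Subset.antisymm
      · rintro _ ⟨x, hx, rfl⟩
        by_contra hy
        exact hy (by rwa [hbij.1 (hfix _ hy)] )
      · intro y hy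
        obtain ⟨x, rfl⟩ := hbij.2 y
        refine ⟨x, ?_, rfl⟩
        by_contra hx
        exact hx (by simpa only [hfix x hx] using hy)
    have hcov := integral_image_eq_integral_abs_det_fderiv_smul volume
      (measurableSet_ball (x := (0 : E)) (ε := 1)) (f := fun x => x + t • g x)
      (f' := fun x => 1 + t • A x)
      (fun x hx => ((hasFDerivAt_id x).add ((hA x hx).const_smul t)).hasFDerivWithinAt)
      hbij.1.injOn (fun _ => (1 : ℝ))
    rw [himage] at hcov
    simp only [smul_eq_mul, mul_one, integral_const, measureReal_restrict_apply_univ] at hcov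
    rw [hcov]
    refine setIntegral_congr_fun measurableSet_ball fun x hx => ?_
    refine (abs_of_pos (ContinuousLinearMap.det_one_add_pos_of_norm_lt_one ?_)).symm
    rw [norm_smul, Real.norm_of_nonneg ht]
    exact (mul_le_mul_of_nonneg_left (hAL x hx) ht).trans_lt htL
  -- The determinant is polynomial in time, so its value at time `1` is a fixed combination of
  -- values at small times.
  obtain ⟨t, c, ht, hc, hp⟩ := exists_interpolation_weights (Module.finrank ℝ E)
    (show (0 : ℝ) < ((L : ℝ) + 1)⁻¹ by positivity)
  have hdet : ∀ x, (1 + A x).det = ∑ i, c i * (1 + t i • A x).det := by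
    intro x
    obtain ⟨p, hpd, hpe⟩ := (A x).exists_polynomial_det_one_add_smul
    have := hp p hpd
    simpa only [hpe, one_smul] using this
  simp_rw [hdet]
  rw [integral_finsetSum _ fun i _ => (hint (t i)).const_mul (c i)]
  simp_rw [integral_const_mul, hsmall _ (ht _).1 (ht _).2, ← Finset.sum_mul, hc, one_mul]

/-- There is no `C¹` retraction of the closed unit ball onto the unit sphere. -/
theorem not_exists_contDiff_retraction {r : E → E}
    (hr : ∀ x ∈ closedBall (0 : E) 1, ContDiffAt ℝ 1 r x)
    (hr1 : ∀ x ∈ closedBall (0 : E) 1, ‖r x‖ = 1) (hfix : ∀ x, ‖x‖ = 1 → r x = x) : False := by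
  let : MeasurableSpace E := borel E
  have : BorelSpace E := ⟨rfl⟩
  obtain ⟨L, hL⟩ := ContDiffOn.exists_lipschitzOnWith
    (f := fun x => r x - x) (s := closedBall (0 : E) 1) (n := 1)
    (fun x hx => ((hr x hx).sub contDiffAt_id).contDiffWithinAt) one_ne_zero
    (convex_closedBall 0 1) (isCompact_closedBall 0 1)
  obtain ⟨P, hPL, hPC, -, hPin⟩ := exists_metricProjection (C := closedBall (0 : E) 1)
    ⟨0, by simp⟩ isClosed_closedBall.isComplete (convex_closedBall 0 1)
  have hPid : ∀ z ∈ closedBall (0 : E) 1, P z = z := by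
    intro z hz
    have := hPin z z hz
    rw [real_inner_self_eq_norm_sq] at this
    have h0 : ‖z - P z‖ = 0 := by nlinarith [norm_nonneg (z - P z)]
    exact (sub_eq_zero.1 (norm_eq_zero.1 h0)).symm
  have hPout : ∀ z, z ∉ ball (0 : E) 1 → ‖P z‖ = 1 := by
    intro z hz
    have hN : 1 ≤ ‖z‖ := by simpa using hz
    have hq : ‖P z‖ ≤ 1 := by simpa using hPC z
    have hN0 : ‖z‖ ≠ 0 := by positivity
    have h1 := hPin z (‖z‖⁻¹ • z) (by simp [norm_smul, hN0])
    have h2 := real_inner_le_norm z (P z)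
    simp only [inner_sub_left, inner_sub_right, inner_smul_right,
      real_inner_self_eq_norm_sq, real_inner_comm z (P z)] at h1
    have h3 : ‖z‖⁻¹ * ‖z‖ ^ 2 = ‖z‖ := by field_simp
    have h4 : ‖z‖⁻¹ * inner ℝ z (P z) ≤ ‖P z‖ := by
      rw [inv_mul_le_iff₀ (by positivity)]; exact h2
    have h5 : inner ℝ (P z) z = inner ℝ z (P z) := real_inner_comm _ _
    by_contra hne
    have hlt := lt_of_le_of_ne hq hne
    nlinarith [norm_nonneg (P z)]
  -- Precomposing with the projection makes the displacement globally Lipschitz and zero off the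
  -- open ball.
  set g : E → E := fun x => r (P x) - P x with hgdef
  have hgL : LipschitzWith L g := by
    have := (hL.comp (hPL.lipschitzOnWith (s := univ)) fun x _ => hPC x)
    rw [mul_one] at this
    exact lipschitzOnWith_univ.1 this
  have hg0 : ∀ x, x ∉ ball (0 : E) 1 → g x = 0 := fun x hx => by
    simp [hgdef, hfix _ (hPout x hx)]
  have hgA : ∀ x ∈ ball (0 : E) 1, HasFDerivAt g (fderiv ℝ r x - 1) x := by
    intro x hx
    have h1 : HasFDerivAt (fun x => r x - x) (fderiv ℝ r x - 1) x :=
      (((hr x (ball_subset_closedBall hx)).differentiableAt one_ne_zero).hasFDerivAt).sub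
        (hasFDerivAt_id x)
    refine h1.congr_of_eventuallyEq ?_
    filter_upwards [isOpen_ball.mem_nhds hx] with y hy
    simp only [hgdef, hPid y (ball_subset_closedBall hy)]
  have hAc : ContinuousOn (fun x => fderiv ℝ r x - 1) (closedBall (0 : E) 1) := fun x hx =>
    (((hr x hx).fderiv_right (m := 0) (by norm_num)).continuousAt.sub
      continuousAt_const).continuousWithinAt
  have hvol := setIntegral_det_one_add_eq_volume hgL hg0 hgA hAc
  -- Since `‖r‖ = 1`, the range of the derivative is orthogonal to `r x ≠ 0`, so the derivative is
  -- singular.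
  have hdet : ∀ x ∈ ball (0 : E) 1, (1 + (fderiv ℝ r x - 1)).det = 0 := by
    intro x hx
    rw [add_sub_cancel]
    have hxr := ((hr x (ball_subset_closedBall hx)).differentiableAt one_ne_zero).hasFDerivAt
    have h1 : HasFDerivAt (fun y => ‖r y‖ ^ 2) _ x := hxr.norm_sq
    have h2 : HasFDerivAt (fun y => ‖r y‖ ^ 2) (0 : E →L[ℝ] ℝ) x := by
      refine (hasFDerivAt_const (1 : ℝ) x).congr_of_eventuallyEq ?_
      filter_upwards [isOpen_ball.mem_nhds hx] with y hy
      simp [hr1 y (ball_subset_closedBall hy)]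
    have h3 := h1.unique h2
    have h4 : ∀ v, inner ℝ (r x) (fderiv ℝ r x v) = (0 : ℝ) := by
      intro v
      simpa using DFunLike.congr_fun h3 v
    by_contra hne
    have hu : IsUnit (LinearMap.det (fderiv ℝ r x : E →ₗ[ℝ] E)) := isUnit_iff_ne_zero.2 hne
    obtain ⟨v, hv⟩ := (LinearEquiv.ofIsUnitDet (v := Module.finBasis ℝ E)
      (v' := Module.finBasis ℝ E) (f := (fderiv ℝ r x : E →ₗ[ℝ] E))
      (by rwa [LinearMap.det_toMatrix])).surjective (r x)
    have h5 := h4 v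
    have hv' : fderiv ℝ r x v = r x := hv
    rw [hv', real_inner_self_eq_norm_sq, hr1 x (ball_subset_closedBall hx)] at h5
    norm_num at h5
  rw [setIntegral_congr_fun measurableSet_ball hdet] at hvol
  simp only [integral_zero] at hvol
  exact (ENNReal.toReal_pos (measure_ball_pos volume (0 : E) one_pos).ne'
    measure_ball_lt_top.ne).ne hvol

end Retraction

/-! ### Brouwer's fixed point theorem -/

section Brouwer

variable {E : Type*} [NormedAddCommGroup E] [InnerProductSpace ℝ E]

/-- The larger root `s` of `‖x + s • u‖ = 1`. -/
noncomputable def sphereHitTime (x u : E) : ℝ :=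
  (-inner ℝ x u + √(inner ℝ x u ^ 2 + ‖u‖ ^ 2 * (1 - ‖x‖ ^ 2))) / ‖u‖ ^ 2

theorem norm_add_sphereHitTime_smul {x u : E} (hu : u ≠ 0)
    (hD : 0 ≤ inner ℝ x u ^ 2 + ‖u‖ ^ 2 * (1 - ‖x‖ ^ 2)) :
    ‖x + sphereHitTime x u • u‖ = 1 := by
  have hu0 : ‖u‖ ≠ 0 := norm_ne_zero_iff.2 hu
  have hsq := Real.sq_sqrt hD
  have h : ‖x + sphereHitTime x u • u‖ ^ 2 = 1 := by
    rw [norm_add_sq_real, norm_smul, inner_smul_right, mul_pow, Real.norm_eq_abs, sq_abs,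
      sphereHitTime]
    field_simp
    nlinarith
  nlinarith [norm_nonneg (x + sphereHitTime x u • u)]

variable [FiniteDimensional ℝ E]

/-- Without a fixed point, following the ray from `f x` through `x` to the sphere would be a `C¹`
retraction. -/
theorem exists_fixedPoint_of_contDiff_of_norm_le_one {f : E → E} (hf : ContDiff ℝ 1 f)
    (hf1 : ∀ x, ‖f x‖ ≤ 1) : ∃ x, f x = x := by
  by_contra! hne
  have hu : ∀ x, x - f x ≠ 0 := fun x h => hne x (sub_eq_zero.1 h).symm
  have hinner : ∀ x : E, ‖x‖ = 1 → 0 < (inner ℝ x (x - f x) : ℝ) := by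
    intro x hx
    rw [inner_sub_right, real_inner_self_eq_norm_sq, hx]
    have h1 := real_inner_le_norm x (f x)
    rw [hx, one_mul] at h1
    rcases (h1.trans (hf1 x)).lt_or_eq with h | h
    · linarith
    · have h2 : ‖f x‖ = 1 := le_antisymm (hf1 x) (h ▸ h1)
      exact absurd ((inner_eq_one_iff_of_norm_eq_one hx h2).1 h).symm (hne x)
  have hD : ∀ x ∈ closedBall (0 : E) 1,
      0 < inner ℝ x (x - f x) ^ 2 + ‖x - f x‖ ^ 2 * (1 - ‖x‖ ^ 2) := by
    intro x hx
    have hx1 : ‖x‖ ≤ 1 := by simpa using hx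
    have hpos := norm_pos_iff.2 (hu x)
    rcases hx1.lt_or_eq with h | h
    · have : 0 < 1 - ‖x‖ ^ 2 := by nlinarith [norm_nonneg x]
      positivity
    · have := hinner x h
      rw [h]
      nlinarith [sq_pos_of_pos this]
  refine not_exists_contDiff_retraction
    (r := fun x => x + sphereHitTime x (x - f x) • (x - f x)) (fun x hx => ?_) (fun x hx => ?_)
    fun x hx => ?_
  · have hux : ContDiffAt ℝ 1 (fun x => x - f x) x := contDiffAt_id.sub hf.contDiffAt
    have hin : ContDiffAt ℝ 1 (fun x => (inner ℝ x (x - f x) : ℝ)) x := contDiffAt_id.inner ℝ hux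
    refine contDiffAt_id.add (ContDiffAt.smul ?_ hux)
    refine ContDiffAt.div (hin.neg.add (ContDiffAt.sqrt ?_ (hD x hx).ne')) (hux.norm_sq ℝ)
      (pow_ne_zero 2 (norm_ne_zero_iff.2 (hu x)))
    exact (hin.pow 2).add ((hux.norm_sq ℝ).mul (contDiffAt_const.sub (contDiffAt_id.norm_sq ℝ)))
  · exact norm_add_sphereHitTime_smul (hu x) (hD x hx).le
  · have : sphereHitTime x (x - f x) = 0 := by
      simp [sphereHitTime, hx, Real.sqrt_sq (hinner x hx).le]
    simp [this]

/-- **Brouwer's fixed point theorem** for maps of a Euclidean space into the unit ball. -/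
theorem Continuous.exists_fixedPoint_of_norm_le_one {f : E → E} (hf : Continuous f)
    (hf1 : ∀ x, ‖f x‖ ≤ 1) : ∃ x, f x = x := by
  by_contra! hne
  obtain ⟨x₀, -, hx₀⟩ := (isCompact_closedBall (0 : E) 1).exists_isMinOn ⟨0, by simp⟩
    (hf.sub continuous_id).norm.continuousOn
  have hδ : 0 < ‖f x₀ - x₀‖ := norm_pos_iff.2 (sub_ne_zero.2 (hne x₀))
  -- A fixed point of a smooth `g` closer to `f` than the minimal displacement on the ball would be
  -- displaced too little by `f`.
  obtain ⟨g, hg⟩ := exists_contMDiffMap_forall_mem_convex_of_local_const (n := 1)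
    (modelWithCornersSelf ℝ E) (t := fun x => ball (f x) ‖f x₀ - x₀‖ ∩ closedBall 0 1)
    (fun x => (convex_ball _ _).inter (convex_closedBall _ _)) fun x => by
      refine ⟨f x, ?_⟩
      filter_upwards [hf.continuousAt.eventually (ball_mem_nhds (f x) hδ)] with y hy
      exact ⟨by rw [mem_ball_comm]; exact hy, by simpa using hf1 x⟩
  obtain ⟨x, hx⟩ := exists_fixedPoint_of_contDiff_of_norm_le_one (f := g)
    (contMDiff_iff_contDiff.1 g.contMDiff) fun x => by simpa using (hg x).2
  have h1 := (hg x).1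
  have h2 : ‖f x₀ - x₀‖ ≤ ‖f x - x‖ := hx₀ (hx ▸ (hg x).2)
  rw [hx, mem_ball, dist_eq_norm, norm_sub_rev] at h1
  exact h1.not_ge h2

theorem Continuous.exists_fixedPoint_of_isBounded_range {f : E → E} (hf : Continuous f)
    (hb : Bornology.IsBounded (range f)) : ∃ x, f x = x := by
  obtain ⟨R, hR, hfR⟩ := hb.exists_pos_norm_le
  obtain ⟨x, hx⟩ := Continuous.exists_fixedPoint_of_norm_le_one
    (f := fun x => R⁻¹ • f (R • x)) (by fun_prop) fun x => by
      rw [norm_smul, norm_inv, Real.norm_of_nonneg hR.le, inv_mul_le_iff₀ hR, mul_one]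
      exact hfR _ (mem_range_self _)
  exact ⟨R • x, (inv_smul_eq_iff₀ hR.ne').1 hx⟩

end Brouwer

/-! ### Proper separation from convex sets -/

section RelativeInterior

variable {E : Type*} [NormedAddCommGroup E] [NormedSpace ℝ E] [FiniteDimensional ℝ E]

/-- If `0 ∉ S`, some functional separates them. With interior, it vanishes on a spanning set, so is
zero; without, the affine span misses `0` and separation is strict. -/
theorem Convex.zero_mem_of_span_eq_top {S : Set E} (hS : Convex ℝ S) (hne : S.Nonempty)
    (hspan : Submodule.span ℝ S = ⊤)
    (hl : ∀ l : E →L[ℝ] ℝ, (∀ x ∈ S, 0 ≤ l x) → ∀ x ∈ S, l x = 0) : (0 : E) ∈ S := by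
  by_contra h0
  by_cases hint : (interior S).Nonempty
  · obtain ⟨f, hf0, hf⟩ := geometric_hahn_banach_of_nonempty_interior_point hS
      (fun h => h0 (interior_subset h)) hint
    refine hf0 ?_
    have hz := hl (-f) fun x hx => by simpa using hf x hx
    have : (f : E →ₗ[ℝ] ℝ) = 0 := LinearMap.ext_on hspan fun x hx => by simpa using hz x hx
    exact ContinuousLinearMap.coe_injective this
  · rw [hS.interior_nonempty_iff_affineSpan_eq_top] at hint
    have h0' : (0 : E) ∉ affineSpan ℝ S := by
      intro h
      refine hint ?_
      rw [← affineSpan_insert_eq_affineSpan ℝ h]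
      apply SetLike.coe_injective
      rw [affineSpan_insert_zero, hspan]
      rfl
    obtain ⟨f, u, hu0, hu⟩ := geometric_hahn_banach_point_closed (affineSpan ℝ S).convex
      (AffineSubspace.closed_of_finiteDimensional (affineSpan ℝ S)) h0'
    rw [map_zero] at hu0
    have hpos : ∀ x ∈ S, 0 < f x := fun x hx => hu0.trans (hu x (subset_affineSpan ℝ S hx))
    obtain ⟨x, hx⟩ := hne
    exact (hpos x hx).ne' (hl f (fun y hy => (hpos y hy).le) x hx)

/-- A point that cannot be properly separated from a convex set belongs to it. -/
theorem Convex.mem_of_forall_not_properly_separated {S : Set E} (hS : Convex ℝ S)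
    (hne : S.Nonempty) {c : E}
    (hl : ∀ l : E →L[ℝ] ℝ, (∀ x ∈ S, l c ≤ l x) → ∀ x ∈ S, l x = l c) : c ∈ S := by
  set W := Submodule.span ℝ ((fun x => x - c) '' S) with hW
  have hmem : ∀ x ∈ S, x - c ∈ W := fun x hx => Submodule.subset_span (mem_image_of_mem _ hx)
  let S' : Set W := {w | (w : E) + c ∈ S}
  have hS'mk : ∀ x (hx : x ∈ S), (⟨x - c, hmem x hx⟩ : W) ∈ S' := fun x hx => by
    simpa [S'] using hx
  have himage : ((↑) : W → E) '' S' = (fun x => x - c) '' S := by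
    ext y
    constructor
    · rintro ⟨w, hw, rfl⟩
      exact ⟨_, hw, by simp⟩
    · rintro ⟨x, hx, rfl⟩
      exact ⟨_, hS'mk x hx, rfl⟩
  have hconv : Convex ℝ S' := by
    have := (hS.translate_preimage_left c).linear_preimage W.subtype
    exact this
  have h0 : (0 : W) ∈ S' := by
    refine hconv.zero_mem_of_span_eq_top ?_ ?_ ?_
    · obtain ⟨x, hx⟩ := hne
      exact ⟨_, hS'mk x hx⟩
    · apply Submodule.map_injective_of_injective W.injective_subtype
      rw [Submodule.map_span, Submodule.map_top, Submodule.range_subtype]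
      exact congrArg (Submodule.span ℝ) himage
    · intro l hlS
      obtain ⟨m, hm⟩ := LinearMap.exists_extend (l : W →ₗ[ℝ] ℝ)
      have hml : ∀ w : W, m w = l w := fun w => LinearMap.congr_fun hm w
      have key := hl (LinearMap.toContinuousLinearMap m) fun x hx => by
        have := hlS _ (hS'mk x hx)
        rw [← hml, map_sub] at this
        simpa using this
      intro w hw
      have := key _ hw
      simpa [hml] using this
  simpa [S'] using h0

end RelativeInterior

/-! ### Michael selections -/

section Selection

variable {X E : Type*} [MetricSpace X] [NormedAddCommGroup E] [NormedSpace ℝ E]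

theorem LowerHemicontinuous.exists_approximate_selection {T : X → Set E}
    (hT : LowerHemicontinuous T) (hconv : ∀ x, Convex ℝ (T x)) (hne : ∀ x, (T x).Nonempty)
    {ε : ℝ} (hε : 0 < ε) : ∃ f : C(X, E), ∀ x, (T x ∩ ball (f x) ε).Nonempty := by
  obtain ⟨f, hf⟩ := exists_continuous_forall_mem_convex_of_local_const
    (t := fun x => thickening ε (T x)) (fun x => (hconv x).thickening ε) fun x => by
      obtain ⟨c, hc⟩ := hne x
      refine ⟨c, ?_⟩
      have hopen := lowerHemicontinuous_iff_isOpen_inter_nonempty.1 hT (ball c ε) isOpen_ball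
      filter_upwards [hopen.mem_nhds ⟨c, hc, mem_ball_self hε⟩] with y ⟨z, hz, hzc⟩
      exact mem_thickening_iff.2 ⟨z, hz, by rwa [dist_comm]⟩
  refine ⟨f, fun x => ?_⟩
  obtain ⟨z, hz, hd⟩ := mem_thickening_iff.1 (hf x)
  exact ⟨z, hz, by rwa [mem_ball, dist_comm]⟩

/-- **Michael's selection theorem**: a lower hemicontinuous map with nonempty convex values admits
a continuous selection of the closures of its values. -/
theorem LowerHemicontinuous.exists_selection_closure [CompleteSpace E] {T : X → Set E}
    (hT : LowerHemicontinuous T) (hconv : ∀ x, Convex ℝ (T x)) (hne : ∀ x, (T x).Nonempty) :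
    ∃ f : C(X, E), ∀ x, f x ∈ closure (T x) := by
  let S : ℕ → Set C(X, E) := fun n => {f | ∀ x, (T x ∩ ball (f x) ((1 / 2) ^ n)).Nonempty}
  have step : ∀ n (f : S n), ∃ f' : S (n + 1), ∀ x, dist (f.1 x) (f'.1 x) ≤ 2 * (1 / 2) ^ n := by
    intro n f
    -- Selecting from the part of `T x` near the current approximation keeps successive
    -- approximations geometrically close.
    have hlsc : LowerHemicontinuous fun x => T x ∩ ball (f.1 x) ((1 / 2) ^ n) :=
      hT.inter_hasOpenCGraph (isOpen_lt (f := fun p : X × E => dist p.2 (f.1 p.1))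
        (by fun_prop) continuous_const)
    obtain ⟨f', hf'⟩ := hlsc.exists_approximate_selection
      (fun x => (hconv x).inter (convex_ball _ _)) f.2 (ε := (1 / 2) ^ (n + 1)) (by positivity)
    refine ⟨⟨f', fun x => ?_⟩, fun x => ?_⟩
    · obtain ⟨y, hy, hyf⟩ := hf' x
      exact ⟨y, hy.1, hyf⟩
    · obtain ⟨y, ⟨-, hy⟩, hyf⟩ := hf' x
      have h1 := dist_triangle_left (f.1 x) (f' x) y
      rw [mem_ball] at hy hyf
      have h2 : (1 / 2 : ℝ) ^ (n + 1) ≤ (1 / 2) ^ n := by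
        rw [pow_succ]; linarith [show (0 : ℝ) < (1 / 2) ^ n by positivity]
      linarith
  choose next hnext using step
  obtain ⟨f₀, hf₀⟩ := hT.exists_approximate_selection hconv hne (ε := (1 / 2) ^ 0) (by simp)
  let F : ∀ n, S n := fun n => Nat.rec ⟨f₀, hf₀⟩ (fun n f => next n f) n
  have hF : ∀ n x, dist ((F n).1 x) ((F (n + 1)).1 x) ≤ 2 * (1 / 2) ^ n := fun n x =>
    hnext n (F n) x
  have hlim : ∀ x, ∃ y, Tendsto (fun n => (F n).1 x) atTop (𝓝 y) := fun x =>
    cauchySeq_tendsto_of_complete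
      (cauchySeq_of_le_geometric (1 / 2) 2 (by norm_num) fun n => hF n x)
  choose g hg using hlim
  have hdist : ∀ n x, dist ((F n).1 x) (g x) ≤ 4 * (1 / 2) ^ n := by
    intro n x
    have := dist_le_of_le_geometric_of_tendsto (1 / 2) 2 (by norm_num) (fun n => hF n x) (hg x) n
    exact this.trans_eq (by ring)
  -- The `5` adds `4` for the distance to the limit and `1` for the distance from the approximation
  -- to `T x`.
  have hpow : Tendsto (fun n : ℕ => 5 * (1 / 2 : ℝ) ^ n) atTop (𝓝 0) := by
    simpa using (tendsto_pow_atTop_nhds_zero_of_lt_one (r := (1 / 2 : ℝ))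
      (by norm_num) (by norm_num)).const_mul 5
  have hunif : TendstoUniformly (fun n x => (F n).1 x) g atTop := by
    rw [Metric.tendstoUniformly_iff]
    intro ε hε
    filter_upwards [hpow.eventually (gt_mem_nhds hε)] with n hn x
    rw [dist_comm]
    linarith [hdist n x, show (0 : ℝ) < (1 / 2) ^ n by positivity]
  refine ⟨⟨g, hunif.continuous (Frequently.of_forall fun n => (F n).1.continuous)⟩, fun x => ?_⟩
  rw [Metric.mem_closure_iff]
  intro ε hε
  obtain ⟨n, hn⟩ := (hpow.eventually (gt_mem_nhds hε)).exists
  obtain ⟨y, hy, hyF⟩ := (F n).2 x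
  refine ⟨y, hy, ?_⟩
  rw [mem_ball] at hyF
  have h1 := dist_triangle_left (g x) y ((F n).1 x)
  have h2 := hdist n x
  rw [dist_comm] at hyF
  simp only [ContinuousMap.coe_mk]
  linarith

open scoped Classical in
/-- Shrinking the values of a lower hemicontinuous map on a closed set preserves lower
hemicontinuity. -/
theorem LowerHemicontinuous.piecewise_of_isClosed {α β : Type*} [TopologicalSpace α]
    [TopologicalSpace β] {T S : α → Set β} {F : Set α} (hT : LowerHemicontinuous T)
    (hF : IsClosed F) (hS : LowerHemicontinuousOn S F) (hST : ∀ x ∈ F, S x ⊆ T x) :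
    LowerHemicontinuous fun x => if x ∈ F then S x else T x := by
  rw [lowerHemicontinuous_iff]
  intro x
  rw [lowerHemicontinuousAt_iff]
  intro V hV hx
  rw [lowerHemicontinuous_iff] at hT
  have hTx := lowerHemicontinuousAt_iff.1 (hT x) V hV
  by_cases hxF : x ∈ F
  · rw [if_pos hxF] at hx
    have h1 := lowerHemicontinuousWithinAt_iff.1 (lowerHemicontinuousOn_iff.1 hS x hxF) V hV hx
    rw [eventually_nhdsWithin_iff] at h1
    filter_upwards [h1, hTx (hx.mono (inter_subset_inter_left _ (hST x hxF)))] with y hy1 hy2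
    split_ifs with hy
    exacts [hy1 hy, hy2]
  · rw [if_neg hxF] at hx
    filter_upwards [hTx hx, hF.isOpen_compl.mem_nhds hxF] with y hy hyF
    rwa [if_neg hyF]

/-- A lower hemicontinuous map with nonempty convex values has countably many continuous
selections of the closures that are dense in each value. -/
theorem LowerHemicontinuous.exists_dense_selections [CompleteSpace E]
    [TopologicalSpace.SeparableSpace E] {T : X → Set E}
    (hT : LowerHemicontinuous T) (hconv : ∀ x, Convex ℝ (T x)) (hne : ∀ x, (T x).Nonempty) :
    ∃ f : ℕ → C(X, E), (∀ n x, f n x ∈ closure (T x)) ∧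
      ∀ x, T x ⊆ closure (range fun n => f n x) := by
  classical
  let q := TopologicalSpace.denseSeq E
  let ρ : ℕ → ℝ := fun k => 1 / ((k : ℝ) + 1)
  have hU : ∀ i k, IsOpen {x | (T x ∩ ball (q i) (ρ k)).Nonempty} := fun i k =>
    lowerHemicontinuous_iff_isOpen_inter_nonempty.1 hT _ isOpen_ball
  -- Open sets are countable unions of closed sets, and on each closed piece `T` may be shrunk to
  -- its part in the ball.
  choose F hFc hFU hFun _ using fun i k => (hU i k).exists_iUnion_isClosed
  have hsel : ∀ i k j, ∃ f : C(X, E), (∀ x, f x ∈ closure (T x)) ∧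
      ∀ x ∈ F i k j, f x ∈ closedBall (q i) (ρ k) := by
    intro i k j
    have hlsc := hT.piecewise_of_isClosed (S := fun x => T x ∩ ball (q i) (ρ k)) (hFc i k j)
      ((hT.inter_hasOpenCGraph (HasOpenCGraph.const isOpen_ball)).lowerHemicontinuousOn _)
      fun x _ => inter_subset_left
    obtain ⟨f, hf⟩ := hlsc.exists_selection_closure
      (fun x => by split_ifs; exacts [(hconv x).inter (convex_ball _ _), hconv x])
      (fun x => by split_ifs with hx; exacts [hFU i k j hx, hne x])
    refine ⟨f, fun x => ?_, fun x hx => ?_⟩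
    · refine closure_mono ?_ (hf x)
      split_ifs
      exacts [inter_subset_left, subset_rfl]
    · have := hf x
      rw [if_pos hx] at this
      exact closure_ball_subset_closedBall (closure_mono inter_subset_right this)
  choose f hfT hfF using hsel
  let e := (Denumerable.eqv (ℕ × ℕ × ℕ)).symm
  refine ⟨fun n => f (e n).1 (e n).2.1 (e n).2.2, fun n x => hfT _ _ _ x, fun x y hy => ?_⟩
  rw [Metric.mem_closure_iff]
  intro ε hε
  obtain ⟨k, hk⟩ := exists_nat_one_div_lt (half_pos hε)
  have hρ : 0 < ρ k := by positivity
  obtain ⟨i, hi⟩ := (TopologicalSpace.denseRange_denseSeq E).exists_dist_lt y hρ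
  have hx : x ∈ ⋃ j, F i k j := by
    rw [hFun]
    exact ⟨y, hy, hi⟩
  obtain ⟨j, hj⟩ := mem_iUnion.1 hx
  refine ⟨_, ⟨e.symm (i, k, j), rfl⟩, ?_⟩
  simp only [Equiv.apply_symm_apply]
  have h1 := mem_closedBall'.1 (hfF i k j x hj)
  have h2 := dist_triangle y (q i) (f i k j x)
  have h3 : dist y (q i) < ρ k := hi
  have h4 : ρ k < ε / 2 := hk
  linarith

/-- **Michael's selection theorem** in finite dimension: a lower hemicontinuous map with nonempty
convex, not necessarily closed, values contained in a bounded set has a continuous selection. -/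
theorem LowerHemicontinuous.exists_selection [FiniteDimensional ℝ E] {T : X → Set E}
    (hT : LowerHemicontinuous T) (hconv : ∀ x, Convex ℝ (T x)) (hne : ∀ x, (T x).Nonempty)
    {R : ℝ} (hR : ∀ x, T x ⊆ closedBall 0 R) : ∃ f : C(X, E), ∀ x, f x ∈ T x := by
  have : CompleteSpace E := FiniteDimensional.complete ℝ E
  have : ProperSpace E := FiniteDimensional.proper ℝ E
  obtain ⟨f, hfT, hfd⟩ := hT.exists_dense_selections hconv hne
  have hfR : ∀ n x, ‖f n x‖ ≤ R := fun n x => by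
    simpa using closure_minimal (hR x) isClosed_closedBall (hfT n x)
  let w : ℕ → ℝ := fun n => 1 / 2 / 2 ^ n
  have hw : HasSum w 1 := hasSum_geometric_two' 1
  have hw0 : ∀ n, 0 < w n := fun n => by positivity
  have hbound : ∀ n x, ‖w n • f n x‖ ≤ w n * R := fun n x => by
    rw [norm_smul, Real.norm_of_nonneg (hw0 n).le]
    exact mul_le_mul_of_nonneg_left (hfR n x) (hw0 n).le
  have hsum : Summable fun n => w n * R := hw.summable.mul_right R
  refine ⟨⟨fun x => ∑' n, w n • f n x, continuous_tsum
    (fun n => (f n).continuous.const_smul (w n)) hsum hbound⟩, fun x => ?_⟩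
  refine (hconv x).mem_of_forall_not_properly_separated (hne x) fun l hl => ?_
  simp only [ContinuousMap.coe_mk] at hl ⊢
  set c := ∑' n, w n • f n x
  have hc : HasSum (fun n => w n • f n x) c :=
    (Summable.of_norm_bounded hsum fun n => hbound n x).hasSum
  have hle : ∀ n, l c ≤ l (f n x) := fun n =>
    closure_minimal (t := {y | l c ≤ l y}) hl (isClosed_le continuous_const l.continuous) (hfT n x)
  -- If `l` is at least `l c` on the value, these terms are nonnegative with sum zero; positive
  -- weights force each to vanish.
  have hzero : HasSum (fun n => w n * (l (f n x) - l c)) 0 := by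
    have := (hc.mapL l).sub (hw.mul_right (l c))
    simpa [mul_sub] using this
  have heq : ∀ n, l (f n x) = l c := fun n => by
    have := congrFun ((hasSum_zero_iff_of_nonneg fun n =>
      mul_nonneg (hw0 n).le (sub_nonneg.2 (hle n))).1 hzero) n
    exact sub_eq_zero.1 ((mul_eq_zero.1 this).resolve_left (hw0 n).ne')
  intro y hy
  refine closure_minimal (t := {y | l y = l c}) ?_ (isClosed_eq l.continuous continuous_const)
    (hfd x hy)
  rintro _ ⟨n, rfl⟩
  exact heq n

end Selection

/-! ### Fixed points and the projected solution -/

/-- A lower hemicontinuous self-map of a Euclidean space with nonempty convex values in a bounded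
set has a fixed point. -/
theorem LowerHemicontinuous.exists_mem_self {E : Type*} [NormedAddCommGroup E]
    [InnerProductSpace ℝ E] [FiniteDimensional ℝ E] {T : E → Set E} (hT : LowerHemicontinuous T)
    (hconv : ∀ x, Convex ℝ (T x)) (hne : ∀ x, (T x).Nonempty) {R : ℝ}
    (hR : ∀ x, T x ⊆ closedBall 0 R) : ∃ x, x ∈ T x := by
  obtain ⟨f, hf⟩ := hT.exists_selection hconv hne hR
  obtain ⟨x, hx⟩ := f.continuous.exists_fixedPoint_of_isBounded_range
    (isBounded_closedBall.subset (range_subset_iff.2 fun x => hR x (hf x)))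
  exact ⟨x, by simpa only [hx] using hf x⟩

theorem LowerHemicontinuous.comp_continuous {α β γ : Type*} [TopologicalSpace α]
    [TopologicalSpace β] [TopologicalSpace γ] {T : β → Set γ} (hT : LowerHemicontinuous T)
    {φ : α → β} (hφ : Continuous φ) : LowerHemicontinuous fun x => T (φ x) :=
  lowerHemicontinuous_iff_isOpen_inter_nonempty.2 fun V hV =>
    (lowerHemicontinuous_iff_isOpen_inter_nonempty.1 hT V hV).preimage hφ

theorem mainTheorem6 (n : ℕ) (C : Set (EuclideanSpace ℝ (Fin n)))
    (hC_closed : IsClosed C) (hC_convex : Convex ℝ C) (hC_nonempty : C.Nonempty)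
    (h : EuclideanSpace ℝ (Fin n) → ℝ)
    (K : C → Set (EuclideanSpace ℝ (Fin n)))
    (hK_nonempty : ∀ x, (K x).Nonempty)
    (hK_relCompact : IsCompact (closure (⋃ x, K x)))
    (hK_lsc : LowerHemicontinuous K)
    (hK_convex : ∀ x, Convex ℝ (K x))
    (hD_closed : IsClosed (projFixSet C K))
    (hH_lsc : LowerHemicontinuous (improvementMap C h K))
    (hH_convex : ∀ p, Convex ℝ (improvementMap C h K p)) :
    ∃ x₀ : C, IsProjectedSolutionQOpt C h K x₀ := by
  classical
  by_contra hno
  obtain ⟨P, hPL, hPC, hPmin, -⟩ := exists_metricProjection hC_nonempty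
    hC_closed.isComplete hC_convex
  let p : EuclideanSpace ℝ (Fin n) → C := fun z => ⟨P z, hPC z⟩
  have hp : Continuous p := hPL.continuous.subtype_mk _
  have hgraph : Continuous fun z => (p z, z) := hp.prodMk continuous_id
  let F := (fun z => (p z, z)) ⁻¹' projFixSet C K
  have hFmem : ∀ z, z ∈ F ↔ z ∈ K (p z) := fun z =>
    ⟨fun hz => hz.1, fun hz => ⟨hz, hPC z, hPmin z⟩⟩
  let S : EuclideanSpace ℝ (Fin n) → Set (EuclideanSpace ℝ (Fin n)) :=
    fun z => {y | y ∈ K (p z) ∧ h y < h z}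
  have hS_lsc : LowerHemicontinuousOn S F := by
    refine semicontinuous_restrict_iff.1 ?_
    exact hH_lsc.comp_continuous (φ := fun z : F => ⟨(p z, z), z.2⟩)
      ((hgraph.comp continuous_subtype_val).subtype_mk _)
  have hS_ne : ∀ z ∈ F, (S z).Nonempty := by
    intro z hz
    by_contra hemp
    refine hno ⟨p z, z, ⟨hz.1, fun y hy => ?_⟩, hz.2⟩
    by_contra! hlt
    exact hemp ⟨y, hy, hlt⟩
  have hT := (hK_lsc.comp_continuous hp).piecewise_of_isClosed (hD_closed.preimage hgraph) hS_lsc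
    fun z _ y hy => hy.1
  obtain ⟨R, hR⟩ := hK_relCompact.isBounded.subset_closedBall 0
  obtain ⟨z, hz⟩ := hT.exists_mem_self
    (fun z => by
      split_ifs with hz
      exacts [hH_convex ⟨(p z, z), hz⟩, hK_convex _])
    (fun z => by
      split_ifs with hz
      exacts [hS_ne z hz, hK_nonempty _])
    (R := R) fun z y hy => by
      have hy' : y ∈ K (p z) := by
        split_ifs at hy
        exacts [hy.1, hy]
      exact hR (subset_closure (mem_iUnion.2 ⟨p z, hy'⟩))
  split_ifs at hz with hzF
  · exact lt_irrefl _ hz.2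
  · exact hzF ((hFmem z).2 hz)
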